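/- A pseudotopological space is a set $X$ with a relation "$\lambda\to x$" between (proper) filters $\lambda$ on $X$ and points $x\in X$ such that: the principal ultrafilter $\dot x$ converges to $x$; if $\lambda\to x$ and $\lambda\subset\lambda'$ then $\lambda'\to x$; and $\lambda\to x$ whenever every ultrafilter $\gamma\supset\lambda$ converges to $x$. A map $f$ is continuous if $\lambda\to x$ implies $f(\lambda)\to f(x)$. Subspaces and products carry the initial structures, and $I=[0,1]$ carries its usual topology. Homotopies are continuous maps $H\colon Y\times I\to X$; a homotopy of maps of pairs or triples is one all of whose stages $H_t$ are maps of pairs or triples. Let $I^n$ be the $n$-cube, $\partial I^n$ its boundary, $J^n=\partial I^n\times I\cup I^n\times\{0\}\subset I^{n+1}$ for $n\ge 1$, and $J^0=\{0\}\subset I$. For a pointed pair $(X,A,x_0)$ of pseudotopological spaces ($A\subset X$ a subspace, $x_0\in A$) put $$\pi_n(X,x_0)=[(I^n,\partial I^n),(X,x_0)]\ (n\ge1),\qquad \pi_{n+1}(X,A,x_0)=[(I^{n+1},\partial I^{n+1},J^n),(X,A,x_0)]\ (n\ge0),$$ the sets of homotopy classes of maps of pairs and of triples, and let $\pi_0(X,x_0)$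 be the set of path components of $X$, pointed by the component of $x_0$. The base point of each of the other sets is the class of the constant map at $x_0$. Concatenation in the first coordinate, $$(f+g)(t_1,t_2,\dots)=\begin{cases}f(2t_1,t_2,\dots), & 0\le t_1\le\tfrac12,\\ g(2t_1-1,t_2,\dots), & \tfrac12\le t_1\le1,\end{cases}$$ makes $\pi_n(X,x_0)$ for $n\ge1$ and $\pi_n(X,A,x_0)$ for $n\ge2$ into groups, whose neutral element is the base point; $\pi_1(X,A,x_0)$, $\pi_0(A,x_0)$ and $\pi_0(X,x_0)$ are pointed sets. **Theorem.** For every pointed pair $(X,A,x_0)$ of pseudotopological spaces, the sequence $$\cdots\to \pi_n(A,x_0)\xrightarrow{i_*}\pi_n(X,x_0)\xrightarrow{j_*}\pi_n(X,A,x_0)\xrightarrow{\partial}\pi_{n-1}(A,x_0)\to\cdots \to \pi_1(X,A,x_0)\xrightarrow{\partial}\pi_0(A,x_0)\xrightarrow{i_*}\pi_0(X,x_0)$$ is exact: at every term with a map into it and a map out of it, the image of the incoming map equals the preimage of the base point under the outgoing map. Here $i_*$ is induced by the inclusion $i\colon(A,x_0)\to(X,x_0)$; $j_*$ is induced by the inclusion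 $j\colon(X,\{x_0\},x_0)\to(X,A,x_0)$, with $\pi_n(X,x_0)$ identified with $\pi_n(X,\{x_0\},x_0)$; and $\partial$ sends the class of $f\colon(I^{n+1},\partial I^{n+1},J^n)\to(X,A,x_0)$ to the class of its restriction to the face $I^n\times\{1\}\cong I^n$, which for $n=0$ is the path component of $f(1)$ in $A$. Moreover these maps are group homomorphisms whenever both their source and their target are groups as above. -/

import Mathlib

universe u v w

namespace PsTop

open Filter Set
open scoped unitInterval Topology

/-! ### Pseudotopological spaces -/

/-- A pseudotopological space (Choquet space), given by its convergent filters.  Mathlib's filters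
include the improper filter `⊥`; by `conv_of_ultrafilter` it converges to every point, so that the
data are the same as a convergence relation for proper filters. -/
class PseudotopologicalSpace (X : Type u) where
  /-- `Conv F x`: the filter `F` converges to `x`. -/
  Conv : Filter X → X → Prop
  conv_mono : ∀ {F G : Filter X} {x : X}, Conv F x → G ≤ F → Conv G x
  conv_pure : ∀ x : X, Conv (pure x) x
  conv_of_ultrafilter : ∀ {F : Filter X} {x : X},
    (∀ U : Ultrafilter X, (U : Filter X) ≤ F → Conv (U : Filter X) x) → Conv F x

open PseudotopologicalSpace

section Basic

variable {X : Type u} {Y : Type v} {Z : Type w}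

theorem exists_ultrafilter_map_eq {F : Filter X} {f : X → Y} {V : Ultrafilter Y}
    (h : (V : Filter Y) ≤ map f F) :
    ∃ U : Ultrafilter X, (U : Filter X) ≤ F ∧ map f (U : Filter X) = V := by
  have hne : (comap f (V : Filter Y) ⊓ F).NeBot := by
    have : (map f (comap f (V : Filter Y) ⊓ F)).NeBot := by
      rw [Filter.push_pull', inf_eq_left.2 h]
      exact V.neBot
    exact (map_neBot_iff f).1 this
  refine ⟨@Ultrafilter.of _ _ hne, (@Ultrafilter.of_le _ _ hne).trans inf_le_right, ?_⟩
  have h1 : map f (@Ultrafilter.of _ _ hne : Filter X) ≤ V :=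
    (map_mono ((@Ultrafilter.of_le _ _ hne).trans inf_le_left)).trans map_comap_le
  have h2 : (@Ultrafilter.of _ _ hne).map f = V := Ultrafilter.coe_le_coe.1 h1
  exact congrArg (fun W : Ultrafilter Y => (W : Filter Y)) h2

theorem conv_map_of_ultrafilter [PseudotopologicalSpace Y] {F : Filter X} {f : X → Y} {y : Y}
    (h : ∀ U : Ultrafilter X, (U : Filter X) ≤ F → Conv (map f (U : Filter X)) y) :
    Conv (map f F) y := by
  refine conv_of_ultrafilter fun V hV => ?_
  obtain ⟨U, hU, hUV⟩ := exists_ultrafilter_map_eq hV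
  rw [← hUV]
  exact h U hU

/-- The pseudotopology of a topological space. -/
@[reducible] def ofTopologicalSpace (X : Type u) [TopologicalSpace X] : PseudotopologicalSpace X where
  Conv F x := F ≤ 𝓝 x
  conv_mono h h' := h'.trans h
  conv_pure x := pure_le_nhds x
  conv_of_ultrafilter h := (le_iff_ultrafilter).2 fun U hU => h U hU

/-- The unit interval carries its usual topology. -/
instance : PseudotopologicalSpace I := ofTopologicalSpace I

/-- The subspace pseudotopology. -/
instance instSubspace [PseudotopologicalSpace X] (A : Set X) : PseudotopologicalSpace A where
  Conv F x := Conv (map Subtype.val F) (x : X)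
  conv_mono h h' := conv_mono h (map_mono h')
  conv_pure x := conv_pure (x : X)
  conv_of_ultrafilter h := conv_map_of_ultrafilter h

/-- The product pseudotopology on `X × Y`. -/
instance instProd [PseudotopologicalSpace X] [PseudotopologicalSpace Y] :
    PseudotopologicalSpace (X × Y) where
  Conv F p := Conv (map Prod.fst F) p.1 ∧ Conv (map Prod.snd F) p.2
  conv_mono h h' := ⟨conv_mono h.1 (map_mono h'), conv_mono h.2 (map_mono h')⟩
  conv_pure p := ⟨conv_pure p.1, conv_pure p.2⟩
  conv_of_ultrafilter h := ⟨conv_map_of_ultrafilter fun U hU => (h U hU).1,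
    conv_map_of_ultrafilter fun U hU => (h U hU).2⟩

/-- The product pseudotopology on a family of spaces. -/
instance instPi {ι : Type v} {X : ι → Type u} [∀ i, PseudotopologicalSpace (X i)] :
    PseudotopologicalSpace (∀ i, X i) where
  Conv F p := ∀ i, Conv (map (fun q : ∀ i, X i => q i) F) (p i)
  conv_mono h h' i := conv_mono (h i) (map_mono h')
  conv_pure p i := conv_pure (p i)
  conv_of_ultrafilter h i := conv_map_of_ultrafilter fun U hU => h U hU i

/-- Continuity of a function between pseudotopological spaces. -/
def PsContinuous [PseudotopologicalSpace X] [PseudotopologicalSpace Y] (f : X → Y) : Prop :=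
  ∀ (F : Filter X) (x : X), Conv F x → Conv (map f F) (f x)

variable [PseudotopologicalSpace X] [PseudotopologicalSpace Y] [PseudotopologicalSpace Z]

theorem PsContinuous.comp {g : Y → Z} {f : X → Y} (hg : PsContinuous g) (hf : PsContinuous f) :
    PsContinuous (fun x => g (f x)) :=
  fun F x h => hg (map f F) (f x) (hf F x h)

theorem psContinuous_id : PsContinuous (fun x : X => x) := fun _ _ h => h

theorem psContinuous_const (y : Y) : PsContinuous (fun _ : X => y) :=
  fun _ _ _ => conv_mono (conv_pure y) (tendsto_const_pure)

theorem psContinuous_fst : PsContinuous (Prod.fst : X × Y → X) := fun _ _ h => h.1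

theorem psContinuous_snd : PsContinuous (Prod.snd : X × Y → Y) := fun _ _ h => h.2

theorem psContinuous_val (A : Set X) : PsContinuous (Subtype.val : A → X) := fun _ _ h => h

theorem PsContinuous.prodMk {f : X → Y} {g : X → Z} (hf : PsContinuous f) (hg : PsContinuous g) :
    PsContinuous (fun x => (f x, g x)) :=
  fun F x h => ⟨hf F x h, hg F x h⟩

theorem PsContinuous.subtypeMk {A : Set Y} {f : X → Y} (hf : PsContinuous f) (h : ∀ x, f x ∈ A) :
    PsContinuous (fun x => (⟨f x, h x⟩ : A)) :=
  fun F x hF => hf F x hF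

/-- Gluing two continuous maps along the two closed halves `u ≤ 1/2` and `u ≥ 1/2`. -/
theorem PsContinuous.glue {u : X → I} (hu : PsContinuous u) {f g : X → Y} (hf : PsContinuous f)
    (hg : PsContinuous g) (hfg : ∀ x, (u x : ℝ) = 1 / 2 → f x = g x) :
    PsContinuous (fun x => if (u x : ℝ) ≤ 1 / 2 then f x else g x) := by
  intro F x hF
  refine conv_map_of_ultrafilter fun U hU => ?_
  have hUx : Conv (U : Filter X) x := conv_mono hF hU
  have hlim : Tendsto (fun x => (u x : ℝ)) (U : Filter X) (𝓝 (u x : ℝ)) :=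
    (continuous_subtype_val.tendsto (u x)).comp (hu _ _ hUx : Tendsto u U (𝓝 (u x)))
  rcases U.em (fun y => (u y : ℝ) ≤ 1 / 2) with h | h
  · have hx : (u x : ℝ) ≤ 1 / 2 := le_of_tendsto hlim h
    have heq : (fun x => if (u x : ℝ) ≤ 1 / 2 then f x else g x) =ᶠ[(U : Filter X)] f :=
      h.mono fun y hy => if_pos hy
    have hval : (if (u x : ℝ) ≤ 1 / 2 then f x else g x) = f x := if_pos hx
    rw [map_congr heq]
    beta_reduce
    rw [hval]
    exact hf _ _ hUx
  · have hx : 1 / 2 ≤ (u x : ℝ) := ge_of_tendsto hlim (h.mono fun y hy => (not_le.1 hy).le)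
    have heq : (fun x => if (u x : ℝ) ≤ 1 / 2 then f x else g x) =ᶠ[(U : Filter X)] g :=
      h.mono fun y hy => if_neg hy
    rw [map_congr heq]
    have hval : (if (u x : ℝ) ≤ 1 / 2 then f x else g x) = g x := by
      split_ifs with h'
      · exact hfg x (le_antisymm h' hx)
      · rfl
    beta_reduce
    rw [hval]
    exact hg _ _ hUx

/-- Continuous maps of pseudotopological spaces. -/
structure PsMap (X : Type u) (Y : Type v) [PseudotopologicalSpace X]
    [PseudotopologicalSpace Y] where
  toFun : X → Y
  continuous_toFun : PsContinuous toFun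

instance : CoeFun (PsMap X Y) (fun _ => X → Y) := ⟨PsMap.toFun⟩

@[ext] theorem PsMap.ext {f g : PsMap X Y} (h : ∀ x, f x = g x) : f = g := by
  cases f; cases g; congr; exact funext h

/-- Composition of continuous maps. -/
def PsMap.comp (g : PsMap Y Z) (f : PsMap X Y) : PsMap X Z :=
  ⟨fun x => g (f x), g.continuous_toFun.comp f.continuous_toFun⟩

/-- The constant map. -/
def PsMap.const (y : Y) : PsMap X Y := ⟨fun _ => y, psContinuous_const y⟩

/-- The inclusion of a subspace. -/
def incl (A : Set X) : PsMap A X := ⟨Subtype.val, psContinuous_val A⟩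

/-- The stage `H_t` of a map `H : X × I → Y`. -/
def PsMap.stage (H : PsMap (X × I) Y) (t : I) : PsMap X Y :=
  ⟨fun x => H (x, t), H.continuous_toFun.comp (psContinuous_id.prodMk (psContinuous_const t))⟩

/-- Two maps are homotopic through maps with the property `P` (for instance maps of pairs). -/
def HomotopicThrough (P : PsMap X Y → Prop) (f g : PsMap X Y) : Prop :=
  ∃ H : PsMap (X × I) Y, H.stage 0 = f ∧ H.stage 1 = g ∧ ∀ t, P (H.stage t)

/-- The map `t ↦ 2 t` on `[0, 1/2]` (constant afterwards). -/
noncomputable def dbl (t : I) : I := projIcc 0 1 zero_le_one (2 * (t : ℝ))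

/-- The map `t ↦ 2 t - 1` on `[1/2, 1]` (constant before). -/
noncomputable def dbl' (t : I) : I := projIcc 0 1 zero_le_one (2 * (t : ℝ) - 1)

theorem continuous_dbl : Continuous dbl := continuous_projIcc.comp (by fun_prop)

theorem continuous_dbl' : Continuous dbl' := continuous_projIcc.comp (by fun_prop)

theorem coe_dbl (t : I) : (dbl t : ℝ) = min 1 (2 * (t : ℝ)) := by
  have := t.2.1
  simp only [dbl, coe_projIcc]
  exact max_eq_right (le_min zero_le_one (by linarith))

theorem coe_dbl' (t : I) : (dbl' t : ℝ) = max 0 (2 * (t : ℝ) - 1) := by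
  have := t.2.2
  simp only [dbl', coe_projIcc]
  rw [min_eq_right (by linarith)]

theorem dbl_zero : dbl 0 = 0 := Subtype.ext (by rw [coe_dbl]; norm_num)

theorem dbl'_one : dbl' 1 = 1 := Subtype.ext (by rw [coe_dbl']; norm_num)

theorem dbl_half {t : I} (h : (t : ℝ) = 1 / 2) : dbl t = 1 :=
  Subtype.ext (by rw [coe_dbl, h]; norm_num)

theorem dbl'_half {t : I} (h : (t : ℝ) = 1 / 2) : dbl' t = 0 :=
  Subtype.ext (by rw [coe_dbl', h]; norm_num)

theorem psContinuous_of_continuous {φ : I → I} (h : Continuous φ) : PsContinuous φ :=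
  fun F x hF => ((map_mono (hF : F ≤ 𝓝 x)).trans (h.tendsto x) : map φ F ≤ 𝓝 (φ x))

theorem HomotopicThrough.refl {P : PsMap X Y → Prop} {f : PsMap X Y} (h : P f) :
    HomotopicThrough P f f :=
  ⟨f.comp ⟨Prod.fst, psContinuous_fst⟩, rfl, rfl, fun _ => h⟩

theorem HomotopicThrough.symm {P : PsMap X Y → Prop} {f g : PsMap X Y}
    (h : HomotopicThrough P f g) : HomotopicThrough P g f := by
  obtain ⟨H, h0, h1, hP⟩ := h
  refine ⟨H.comp ⟨fun p => (p.1, unitInterval.symm p.2), psContinuous_fst.prodMk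
    ((psContinuous_of_continuous unitInterval.continuous_symm).comp psContinuous_snd)⟩, ?_, ?_,
    fun t => hP (unitInterval.symm t)⟩
  · rw [← h1]; ext x; simp [PsMap.stage, PsMap.comp]
  · rw [← h0]; ext x; simp [PsMap.stage, PsMap.comp]

theorem HomotopicThrough.trans {P : PsMap X Y → Prop} {f g k : PsMap X Y}
    (h : HomotopicThrough P f g) (h' : HomotopicThrough P g k) : HomotopicThrough P f k := by
  obtain ⟨H, h0, h1, hP⟩ := h
  obtain ⟨K, k0, k1, kP⟩ := h'
  have hc : PsContinuous (fun p : X × I => if (p.2 : ℝ) ≤ 1 / 2 then H (p.1, dbl p.2)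
      else K (p.1, dbl' p.2)) := by
    refine PsContinuous.glue psContinuous_snd
      (H.continuous_toFun.comp (psContinuous_fst.prodMk
        ((psContinuous_of_continuous continuous_dbl).comp psContinuous_snd)))
      (K.continuous_toFun.comp (psContinuous_fst.prodMk
        ((psContinuous_of_continuous continuous_dbl').comp psContinuous_snd))) ?_
    intro p hp
    have e1 : H (p.1, 1) = g p.1 := congrArg (fun q : PsMap X Y => q p.1) h1
    have e2 : K (p.1, 0) = g p.1 := congrArg (fun q : PsMap X Y => q p.1) k0
    rw [dbl_half hp, dbl'_half hp, e1, e2]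
  refine ⟨⟨_, hc⟩, ?_, ?_, fun t => ?_⟩
  · rw [← h0]; ext x; simp [PsMap.stage, dbl_zero]
  · rw [← k1]; ext x
    have : ¬ ((1 : ℝ) ≤ 1 / 2) := by norm_num
    simp only [PsMap.stage, dbl'_one, Set.Icc.coe_one, if_neg this]
  · by_cases ht : (t : ℝ) ≤ 1 / 2
    · convert! hP (dbl t) using 1
      ext x; simp only [PsMap.stage, if_pos ht]
    · convert! kP (dbl' t) using 1
      ext x; simp only [PsMap.stage, if_neg ht]

/-- The homotopy relation on the maps with the property `P`. -/
instance homotopySetoid (P : PsMap X Y → Prop) : Setoid {f : PsMap X Y // P f} where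
  r f g := HomotopicThrough P f.1 g.1
  iseqv := ⟨fun f => .refl f.2, .symm, .trans⟩

/-- Homotopy classes of maps with the property `P`, through homotopies all of whose stages have
the property `P`. -/
def HomotopyClasses (P : PsMap X Y → Prop) : Type _ := Quotient (homotopySetoid P)

/-- The homotopy class of a map. -/
def HomotopyClasses.mk {P : PsMap X Y → Prop} (f : PsMap X Y) (h : P f) : HomotopyClasses P :=
  Quotient.mk (homotopySetoid P) ⟨f, h⟩

/-- The map of homotopy classes given by composition with `g`. -/
def HomotopyClasses.postcomp {P : PsMap X Y → Prop} {Q : PsMap X Z → Prop} (g : PsMap Y Z)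
    (h : ∀ f, P f → Q (g.comp f)) : HomotopyClasses P → HomotopyClasses Q :=
  Quotient.map (fun f => ⟨g.comp f.1, h f.1 f.2⟩) (by
    rintro f f' ⟨H, h0, h1, hP⟩
    exact ⟨g.comp H, congrArg g.comp h0, congrArg g.comp h1, fun t => h _ (hP t)⟩)

/-- `f : (X, A) → (Y, B)` is a map of pairs. -/
def IsMapOfPairs (A : Set X) (B : Set Y) (f : PsMap X Y) : Prop :=
  ∀ x ∈ A, f x ∈ B

/-- `f : (X, A, A') → (Y, B, B')` is a map of triples. -/
def IsMapOfTriples (A A' : Set X) (B B' : Set Y) (f : PsMap X Y) : Prop :=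
  (∀ x ∈ A, f x ∈ B) ∧ ∀ x ∈ A', f x ∈ B'

end Basic

/-! ### Path components -/

section PathComponents

variable {X : Type u} {Y : Type v} [PseudotopologicalSpace X] [PseudotopologicalSpace Y]

/-- `x` and `y` are joined by a path. -/
def JoinedByPath (x y : X) : Prop := ∃ α : PsMap I X, α 0 = x ∧ α 1 = y

/-- Being joined by a path is an equivalence relation. -/
instance pathSetoid (X : Type u) [PseudotopologicalSpace X] : Setoid X where
  r := JoinedByPath
  iseqv := by
    refine ⟨fun x => ⟨PsMap.const x, rfl, rfl⟩, ?_, ?_⟩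
    · rintro x y ⟨α, h0, h1⟩
      refine ⟨α.comp ⟨unitInterval.symm,
        psContinuous_of_continuous unitInterval.continuous_symm⟩, ?_, ?_⟩
      · simp [PsMap.comp, h1]
      · simp [PsMap.comp, h0]
    · rintro x y z ⟨α, h0, h1⟩ ⟨β, k0, k1⟩
      refine ⟨⟨fun t => if (t : ℝ) ≤ 1 / 2 then α (dbl t) else β (dbl' t),
        PsContinuous.glue psContinuous_id
          (α.continuous_toFun.comp (psContinuous_of_continuous continuous_dbl))
          (β.continuous_toFun.comp (psContinuous_of_continuous continuous_dbl')) ?_⟩, ?_, ?_⟩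
      · intro t ht
        rw [dbl_half ht, dbl'_half ht, h1, k0]
      · simp [dbl_zero, h0]
      · have : ¬ ((1 : ℝ) ≤ 1 / 2) := by norm_num
        simp only [Set.Icc.coe_one, if_neg this, dbl'_one, k1]

/-- `π₀(X, x₀)`: the set of path components of `X`, pointed by the component of `x₀`. -/
def Pi0 (X : Type u) [PseudotopologicalSpace X] (_x₀ : X) : Type u := Quotient (pathSetoid X)

/-- The path component of `x`. -/
def Pi0.mk (x₀ x : X) : Pi0 X x₀ := Quotient.mk (pathSetoid X) x

/-- The base point of `π₀(X, x₀)`, written `0`. -/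
instance (x₀ : X) : Zero (Pi0 X x₀) := ⟨Pi0.mk x₀ x₀⟩

/-- The map `π₀(X, x₀) → π₀(Y, f(x₀))` induced by `f`. -/
def Pi0.map (f : PsMap X Y) (x₀ : X) : Pi0 X x₀ → Pi0 Y (f x₀) :=
  Quotient.map f.toFun (by
    rintro x y ⟨α, h0, h1⟩
    exact ⟨f.comp α, congrArg f.toFun h0, congrArg f.toFun h1⟩)

end PathComponents

/-! ### Cubes -/

/-- The cube `I^n`, with the product structure. -/
abbrev PsCube (n : ℕ) : Type := Fin n → I

/-- The boundary `∂I^n`. -/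
def bd (n : ℕ) : Set (PsCube n) := {t | ∃ i, t i = 0 ∨ t i = 1}

/-- The set `J^n = ∂I^n × I ∪ I^n × {0}` in `I^{n+1}`; `J^0 = {0}`. -/
def horn (n : ℕ) : Set (PsCube (n + 1)) :=
  {t | (fun i : Fin n => t i.castSucc) ∈ bd n ∨ t (Fin.last n) = 0}

theorem conv_cube_iff {n : ℕ} {F : Filter (PsCube n)} {t : PsCube n} :
    Conv F t ↔ F ≤ 𝓝 t :=
  (tendsto_pi_nhds (f := fun q : PsCube n => q)).symm

theorem conv_cube_prod_iff {n : ℕ} {F : Filter (PsCube n × I)} {p : PsCube n × I} :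
    Conv F p ↔ F ≤ 𝓝 p := by
  constructor
  · rintro ⟨h1, h2⟩
    have h1' : Tendsto Prod.fst F (𝓝 p.1) := conv_cube_iff.1 h1
    have h2' : Tendsto Prod.snd F (𝓝 p.2) := h2
    exact h1'.prodMk_nhds h2'
  · intro h
    exact ⟨conv_cube_iff.2 ((continuous_fst.tendsto p).mono_left h),
      ((continuous_snd.tendsto p).mono_left h : map Prod.snd F ≤ 𝓝 p.2)⟩

theorem psContinuous_cube {m n : ℕ} {φ : PsCube m → PsCube n} (h : Continuous φ) :
    PsContinuous φ :=
  fun _ t hF => conv_cube_iff.2 ((h.tendsto t).mono_left (conv_cube_iff.1 hF))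

theorem psContinuous_cube_prod {m n : ℕ} {φ : PsCube m × I → PsCube n} (h : Continuous φ) :
    PsContinuous φ :=
  fun _ t hF => conv_cube_iff.2 ((h.tendsto t).mono_left (conv_cube_prod_iff.1 hF))

theorem psContinuous_eval {n : ℕ} (i : Fin n) : PsContinuous (fun t : PsCube n => t i) :=
  fun _ _ h => h i

/-! ### Concatenation in the first coordinate -/

section Concatenation

variable {X : Type u} [PseudotopologicalSpace X] {n : ℕ}

/-- Apply `φ` to the first coordinate. -/
def first (φ : I → I) (t : PsCube (n + 1)) : PsCube (n + 1) := Function.update t 0 (φ (t 0))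

theorem continuous_first {φ : I → I} (h : Continuous φ) :
    Continuous (first φ : PsCube (n + 1) → PsCube (n + 1)) :=
  continuous_id.update 0 (h.comp (continuous_apply 0))

@[simp] theorem first_zero (φ : I → I) (t : PsCube (n + 1)) : first φ t 0 = φ (t 0) := by
  simp [first]

@[simp] theorem first_succ (φ : I → I) (t : PsCube (n + 1)) (i : Fin n) :
    first φ t i.succ = t i.succ := by
  simp [first]

theorem first_first (φ ψ : I → I) (t : PsCube (n + 1)) :
    first φ (first ψ t) = first (fun s => φ (ψ s)) t := by
  funext i
  refine Fin.cases ?_ (fun j => ?_) i <;> simp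

theorem first_congr {φ ψ : I → I} {t : PsCube (n + 1)} (h : φ (t 0) = ψ (t 0)) :
    first φ t = first ψ t := by
  simp [first, h]

theorem first_id (t : PsCube (n + 1)) : first (fun s => s) t = t := by simp [first]

/-- The function `f + g`, equal to `f(2t₁, t₂, …)` for `t₁ ≤ 1/2` and to
`g(2t₁ - 1, t₂, …)` for `t₁ ≥ 1/2`. -/
noncomputable def concatFun (f g : PsCube (n + 1) → X) (t : PsCube (n + 1)) : X :=
  if (t 0 : ℝ) ≤ 1 / 2 then f (first dbl t) else g (first dbl' t)

/-- A condition on maps of cubes which says that the two faces `t₁ = 0` and `t₁ = 1` go to `x₀`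
and that `f(t)` lies in a set, containing `x₀`, which depends on `t₂, …` only. -/
structure IsConcatenable (P : PsMap (PsCube (n + 1)) X → Prop) (x₀ : X)
    (R : (Fin n → I) → Set X) : Prop where
  mem : ∀ y, x₀ ∈ R y
  iff : ∀ f, P f ↔ ∀ t, f t ∈ R (fun i => t i.succ) ∧ (t 0 = 0 ∨ t 0 = 1 → f t = x₀)

variable {P : PsMap (PsCube (n + 1)) X → Prop} {x₀ : X} {R : (Fin n → I) → Set X}

theorem IsConcatenable.const (h : IsConcatenable P x₀ R) : P (PsMap.const x₀) :=
  (h.iff _).2 fun _ => ⟨h.mem _, fun _ => rfl⟩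

theorem IsConcatenable.eq_of_zero (h : IsConcatenable P x₀ R) {f} (hf : P f)
    {t : PsCube (n + 1)} (ht : t 0 = 0) : f t = x₀ := ((h.iff f).1 hf t).2 (Or.inl ht)

theorem IsConcatenable.eq_of_one (h : IsConcatenable P x₀ R) {f} (hf : P f)
    {t : PsCube (n + 1)} (ht : t 0 = 1) : f t = x₀ := ((h.iff f).1 hf t).2 (Or.inr ht)

theorem IsConcatenable.psContinuous (h : IsConcatenable P x₀ R) {f g} (hf : P f) (hg : P g) :
    PsContinuous (concatFun f.toFun g.toFun) := by
  refine PsContinuous.glue (psContinuous_eval 0)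
    (f.continuous_toFun.comp (psContinuous_cube (continuous_first continuous_dbl)))
    (g.continuous_toFun.comp (psContinuous_cube (continuous_first continuous_dbl'))) ?_
  intro t ht
  rw [h.eq_of_one hf (by simp [dbl_half ht]), h.eq_of_zero hg (by simp [dbl'_half ht])]

/-- The map `f + g`. -/
noncomputable def IsConcatenable.concat (h : IsConcatenable P x₀ R) {f g} (hf : P f) (hg : P g) :
    PsMap (PsCube (n + 1)) X :=
  ⟨concatFun f.toFun g.toFun, h.psContinuous hf hg⟩

theorem IsConcatenable.concat_mem (h : IsConcatenable P x₀ R) {f g} (hf : P f) (hg : P g) :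
    P (h.concat hf hg) := by
  refine (h.iff _).2 fun t => ⟨?_, ?_⟩
  · have e1 := ((h.iff f).1 hf (first dbl t)).1
    have e2 := ((h.iff g).1 hg (first dbl' t)).1
    simp only [first_succ] at e1 e2
    simp only [concat, concatFun]
    split_ifs
    exacts [e1, e2]
  · rintro (ht | ht)
    · simp only [concat, concatFun, ht]
      rw [if_pos (by norm_num)]
      exact h.eq_of_zero hf (by simp [ht, dbl_zero])
    · simp only [concat, concatFun, ht]
      rw [if_neg (by norm_num)]
      exact h.eq_of_one hg (by simp [ht, dbl'_one])

theorem IsConcatenable.concat_congr (h : IsConcatenable P x₀ R) {f g f' g'} (hf : P f) (hg : P g)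
    (hf' : P f') (hg' : P g') (hff : HomotopicThrough P f f') (hgg : HomotopicThrough P g g') :
    HomotopicThrough P (h.concat hf hg) (h.concat hf' hg') := by
  obtain ⟨H, h0, h1, hP⟩ := hff
  obtain ⟨K, k0, k1, kP⟩ := hgg
  have hfst : PsContinuous (fun p : PsCube (n + 1) × I => p.1 0) :=
    (psContinuous_eval 0).comp psContinuous_fst
  have hd : ∀ φ : I → I, Continuous φ →
      PsContinuous (fun p : PsCube (n + 1) × I => (first φ p.1, p.2)) := fun φ hφ =>
    ((psContinuous_cube (continuous_first hφ)).comp psContinuous_fst).prodMk psContinuous_snd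
  refine ⟨⟨fun p => if (p.1 0 : ℝ) ≤ 1 / 2 then H (first dbl p.1, p.2)
    else K (first dbl' p.1, p.2), PsContinuous.glue hfst
      (H.continuous_toFun.comp (hd _ continuous_dbl))
      (K.continuous_toFun.comp (hd _ continuous_dbl')) ?_⟩, ?_, ?_, ?_⟩
  · intro p hp
    have e1 : H (first dbl p.1, p.2) = x₀ :=
      h.eq_of_one (hP p.2) (t := first dbl p.1) (by simp [dbl_half hp])
    have e2 : K (first dbl' p.1, p.2) = x₀ :=
      h.eq_of_zero (kP p.2) (t := first dbl' p.1) (by simp [dbl'_half hp])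
    rw [e1, e2]
  · subst h0 k0; rfl
  · subst h1 k1; rfl
  · intro t
    exact h.concat_mem (hP t) (kP t)

/-- Reparametrization of the first coordinate. -/
def reparam (f : PsMap (PsCube (n + 1)) X) (φ : I → I) (hφ : Continuous φ) :
    PsMap (PsCube (n + 1)) X :=
  f.comp ⟨first φ, psContinuous_cube (continuous_first hφ)⟩

theorem IsConcatenable.reparam_mem (h : IsConcatenable P x₀ R) {f} (hf : P f) {φ : I → I}
    (hφ : Continuous φ) (h0 : φ 0 = 0 ∨ φ 0 = 1) (h1 : φ 1 = 0 ∨ φ 1 = 1) :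
    P (reparam f φ hφ) := by
  refine (h.iff _).2 fun t => ?_
  have e := (h.iff f).1 hf (first φ t)
  simp only [first_succ, first_zero] at e
  refine ⟨e.1, ?_⟩
  rintro (ht | ht)
  · exact e.2 (ht ▸ h0)
  · exact e.2 (ht ▸ h1)

theorem IsConcatenable.reparam_homotopic (h : IsConcatenable P x₀ R) {f} (hf : P f)
    {φ ψ : I → I} (hφ : Continuous φ) (hψ : Continuous ψ) (h0 : φ 0 = 0 ∨ φ 0 = 1)
    (h1 : φ 1 = 0 ∨ φ 1 = 1) (e0 : φ 0 = ψ 0) (e1 : φ 1 = ψ 1) :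
    HomotopicThrough P (reparam f φ hφ) (reparam f ψ hψ) := by
  let θ : I → I → I := fun s t => ⟨(1 - (s : ℝ)) * (φ t : ℝ) + (s : ℝ) * (ψ t : ℝ), by
    have h1 : (0 : ℝ) ≤ s := s.2.1
    have h2 : (s : ℝ) ≤ 1 := s.2.2
    exact (convex_Icc (0 : ℝ) 1) (φ t).2 (ψ t).2 (sub_nonneg.2 h2) h1 (sub_add_cancel 1 _)⟩
  have hθ : Continuous (fun p : PsCube (n + 1) × I => θ p.2 (p.1 0)) := by
    refine Continuous.subtype_mk ?_ _
    have a1 : Continuous (fun p : PsCube (n + 1) × I => (p.2 : ℝ)) :=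
      continuous_subtype_val.comp continuous_snd
    have a2 : Continuous (fun p : PsCube (n + 1) × I => p.1 0) :=
      (continuous_apply 0).comp continuous_fst
    exact ((continuous_const.sub a1).mul (continuous_subtype_val.comp (hφ.comp a2))).add
      (a1.mul (continuous_subtype_val.comp (hψ.comp a2)))
  have hθs : ∀ s, Continuous (θ s) := fun s => by
    refine Continuous.subtype_mk ?_ _
    exact (continuous_const.mul (continuous_subtype_val.comp hφ)).add
      (continuous_const.mul (continuous_subtype_val.comp hψ))
  have hF : Continuous (fun p : PsCube (n + 1) × I => first (θ p.2) p.1) :=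
    continuous_fst.update 0 hθ
  have c0 : ∀ s, θ s 0 = φ 0 := fun s => Subtype.ext (by simp only [θ, ← e0]; ring)
  have c1 : ∀ s, θ s 1 = φ 1 := fun s => Subtype.ext (by simp only [θ, ← e1]; ring)
  refine ⟨f.comp ⟨_, psContinuous_cube_prod hF⟩, ?_, ?_, fun s => ?_⟩
  · ext t
    have : θ 0 = φ := funext fun t => Subtype.ext (by simp [θ])
    simp only [PsMap.stage, PsMap.comp, reparam, this]
  · ext t
    have : θ 1 = ψ := funext fun t => Subtype.ext (by simp [θ])
    simp only [PsMap.stage, PsMap.comp, reparam, this]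
  · exact h.reparam_mem hf (hθs s) (by rw [c0]; exact h0) (by rw [c1]; exact h1)

/-- The group of homotopy classes under concatenation in the first coordinate; the neutral element
is the class of the constant map. -/
@[reducible] noncomputable def IsConcatenable.addGroup (h : IsConcatenable P x₀ R) :
    AddGroup (HomotopyClasses P) :=
  letI : Add (HomotopyClasses P) := ⟨Quotient.map₂
    (fun f g => ⟨h.concat f.2 g.2, h.concat_mem f.2 g.2⟩)
    (fun f f' hf g g' hg => h.concat_congr f.2 g.2 f'.2 g'.2 hf hg)⟩
  letI : Zero (HomotopyClasses P) := ⟨HomotopyClasses.mk (PsMap.const x₀) h.const⟩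
  letI : Neg (HomotopyClasses P) := ⟨Quotient.map
    (fun f => ⟨reparam f.1 unitInterval.symm unitInterval.continuous_symm,
      h.reparam_mem f.2 _ (by simp) (by simp)⟩)
    (by
      rintro ⟨f, hf⟩ ⟨g, hg⟩ ⟨H, h0, h1, hP⟩
      dsimp only at h0 h1
      subst h0 h1
      refine ⟨H.comp ⟨fun p => (first unitInterval.symm p.1, p.2),
        ((psContinuous_cube (continuous_first unitInterval.continuous_symm)).comp
          psContinuous_fst).prodMk psContinuous_snd⟩, rfl, rfl, fun t => ?_⟩
      · exact h.reparam_mem (hP t) unitInterval.continuous_symm (by simp) (by simp))⟩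
  AddGroup.ofLeftAxioms
    (by
      rintro ⟨f⟩ ⟨g⟩ ⟨k⟩
      refine Quotient.sound ?_
      change HomotopicThrough P (h.concat (h.concat_mem f.2 g.2) k.2)
        (h.concat f.2 (h.concat_mem g.2 k.2))
      let φ : I → I := fun t =>
        ⟨min (2 * (t : ℝ)) (min ((t : ℝ) + 1 / 4) (((t : ℝ) + 1) / 2)), by
          have h1 := t.2.1
          have h2 := t.2.2
          refine ⟨le_min (by linarith) (le_min (by linarith) (by linarith)), ?_⟩
          exact (min_le_right _ _).trans ((min_le_right _ _).trans (by linarith))⟩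
      have hφ : Continuous φ := Continuous.subtype_mk (by fun_prop) _
      have p0 : φ 0 = 0 := Subtype.ext (by simp [φ])
      have p1 : φ 1 = 1 := Subtype.ext (by simp [φ])
      have key := h.reparam_homotopic (h.concat_mem f.2 (h.concat_mem g.2 k.2)) hφ
        continuous_id (Or.inl p0) (Or.inr p1) p0 p1
      convert! key using 1
      · ext t
        simp only [IsConcatenable.concat, reparam, PsMap.comp, concatFun, first_zero, first_first]
        have h1 := (t 0).2.1
        have h2 := (t 0).2.2
        have hv : ((φ (t 0) : I) : ℝ)
          = min (2 * (t 0 : ℝ)) (min ((t 0 : ℝ) + 1 / 4) (((t 0 : ℝ) + 1) / 2)) := rfl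
        by_cases c : (t 0 : ℝ) ≤ 1 / 2
        · rw [if_pos c]
          have d1 : (dbl (t 0) : ℝ) = 2 * (t 0 : ℝ) := by
            rw [coe_dbl, min_eq_right (by linarith)]
          by_cases c' : (t 0 : ℝ) ≤ 1 / 4
          · have hv' : ((φ (t 0) : I) : ℝ) = 2 * (t 0 : ℝ) := by
              rw [hv, min_eq_left (le_min (by linarith) (by linarith))]
            rw [if_pos (by rw [d1]; linarith), if_pos (by rw [hv']; linarith)]
            refine congrArg _ (first_congr (Subtype.ext ?_))
            rw [coe_dbl (dbl (t 0)), coe_dbl (φ (t 0)), d1, hv']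
          · have hv' : ((φ (t 0) : I) : ℝ) = (t 0 : ℝ) + 1 / 4 := by
              rw [hv, min_eq_right, min_eq_left]
              · linarith
              · exact (min_le_left _ _).trans (by linarith)
            have d2 : (dbl' (φ (t 0)) : ℝ) = 2 * (t 0 : ℝ) - 1 / 2 := by
              rw [coe_dbl', hv', max_eq_right (by linarith)]; ring
            rw [if_neg (by rw [d1]; linarith), if_neg (by rw [hv']; linarith),
              if_pos (by rw [d2]; linarith)]
            refine congrArg _ (first_congr (Subtype.ext ?_))
            rw [coe_dbl' (dbl (t 0)), coe_dbl (dbl' (φ (t 0))), d1, d2, min_eq_right (by linarith), max_eq_right (by linarith)]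
            ring
        · have hv' : ((φ (t 0) : I) : ℝ) = ((t 0 : ℝ) + 1) / 2 := by
            rw [hv, min_eq_right, min_eq_right]
            · linarith
            · exact (min_le_right _ _).trans (by linarith)
          have d2 : (dbl' (φ (t 0)) : ℝ) = (t 0 : ℝ) := by
            rw [coe_dbl', hv', max_eq_right (by linarith)]; ring
          rw [if_neg c, if_neg (by rw [hv']; linarith), if_neg (by rw [d2]; linarith)]
          refine congrArg _ (first_congr (Subtype.ext ?_))
          rw [coe_dbl', coe_dbl', d2]
      · ext t
        simp only [reparam, PsMap.comp]
        exact congrArg _ (first_id t).symm)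
    (by
      rintro ⟨f⟩
      refine Quotient.sound ?_
      change HomotopicThrough P (h.concat h.const f.2) f.1
      have p0 : dbl' 0 = 0 := Subtype.ext (by rw [coe_dbl']; norm_num)
      have key := h.reparam_homotopic f.2 continuous_dbl' continuous_id
        (Or.inl p0) (Or.inr dbl'_one) p0 dbl'_one
      convert! key using 1
      · ext t
        simp only [IsConcatenable.concat, reparam, PsMap.comp, concatFun]
        split_ifs with c
        · refine (h.eq_of_zero f.2 (Subtype.ext ?_)).symm
          rw [first_zero, coe_dbl', max_eq_left (by linarith)]; rfl
        · rfl
      · ext t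
        simp only [reparam, PsMap.comp]
        exact congrArg _ (first_id t).symm)
    (by
      rintro ⟨f⟩
      refine Quotient.sound ?_
      change HomotopicThrough P (h.concat (h.reparam_mem f.2 unitInterval.continuous_symm
        (by simp) (by simp)) f.2) (PsMap.const x₀)
      let φ : I → I := fun t => ⟨|2 * (t : ℝ) - 1|, abs_nonneg _, by
        have h1 := t.2.1
        have h2 := t.2.2
        exact abs_le.2 ⟨by linarith, by linarith⟩⟩
      have hφ : Continuous φ := Continuous.subtype_mk (by fun_prop) _
      have p0 : φ 0 = 1 := Subtype.ext (by simp [φ])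
      have p1 : φ 1 = 1 := Subtype.ext (by simp [φ]; norm_num)
      have key := h.reparam_homotopic f.2 hφ (continuous_const (y := (1 : I)))
        (Or.inr p0) (Or.inr p1) p0 p1
      convert! key using 1
      · ext t
        simp only [IsConcatenable.concat, reparam, PsMap.comp, concatFun, first_first]
        split_ifs with c
        · refine congrArg _ (first_congr (Subtype.ext ?_))
          simp only [φ, unitInterval.coe_symm_eq]
          rw [coe_dbl, min_eq_right (by linarith), abs_of_nonpos (by linarith)]
          ring
        · refine congrArg _ (first_congr (Subtype.ext ?_))
          simp only [φ]
          rw [coe_dbl', max_eq_right (by linarith), abs_of_nonneg (by linarith)]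
      · ext t
        simp only [reparam, PsMap.comp]
        exact (h.eq_of_one f.2 (by simp)).symm)

end Concatenation

/-! ### Homotopy groups -/

section HomotopyGroups

variable {X : Type u} {Y : Type v} [PseudotopologicalSpace X] [PseudotopologicalSpace Y]

/-- `π_n(X, x₀) = [(I^n, ∂I^n), (X, x₀)]`, for `n ≥ 1`. -/
def HomotopyGroup (n : ℕ) (X : Type u) [PseudotopologicalSpace X] (x₀ : X) : Type u :=
  HomotopyClasses (IsMapOfPairs (bd n) ({x₀} : Set X))

theorem isConcatenable_pairs (n : ℕ) (x₀ : X) :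
    IsConcatenable (IsMapOfPairs (bd (n + 1)) ({x₀} : Set X)) x₀
      (fun y => {x | y ∈ bd n → x = x₀}) where
  mem _ _ := rfl
  iff f := by
    constructor
    · intro h t
      exact ⟨fun ⟨i, hi⟩ => h t ⟨i.succ, hi⟩, fun ht => h t ⟨0, ht⟩⟩
    · rintro h t ⟨i, hi⟩
      revert hi
      refine Fin.cases (fun hi => (h t).2 hi) (fun j hj => (h t).1 ⟨j, hj⟩) i

/-- The group structure of `π_n(X, x₀)`, `n ≥ 1`: concatenation in the first coordinate. -/
noncomputable instance (n : ℕ) (x₀ : X) : AddGroup (HomotopyGroup (n + 1) X x₀) :=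
  (isConcatenable_pairs n x₀).addGroup

/-- The neutral element of `π_n(X, x₀)`, `n ≥ 1`, is the class of the constant map. -/
theorem HomotopyGroup.zero_eq (n : ℕ) (x₀ : X) : (0 : HomotopyGroup (n + 1) X x₀) =
    HomotopyClasses.mk (P := IsMapOfPairs (bd (n + 1)) ({x₀} : Set X)) (PsMap.const x₀)
      (fun _ _ => rfl) := rfl

/-- `π_{n+1}(X, A, x₀) = [(I^{n+1}, ∂I^{n+1}, J^n), (X, A, x₀)]`, for `n ≥ 0`: note the index. -/
def RelHomotopyGroup (n : ℕ) (X : Type u) [PseudotopologicalSpace X] (A : Set X) (x₀ : A) :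
    Type u :=
  HomotopyClasses (IsMapOfTriples (bd (n + 1)) (horn n) A ({(x₀ : X)} : Set X))

theorem isConcatenable_triples (n : ℕ) (A : Set X) (x₀ : A) :
    IsConcatenable (IsMapOfTriples (bd (n + 2)) (horn (n + 1)) A ({(x₀ : X)} : Set X)) (x₀ : X)
      (fun y => {x | (y ∈ bd (n + 1) → x ∈ A) ∧ (y ∈ horn n → x = x₀)}) where
  mem _ := ⟨fun _ => x₀.2, fun _ => rfl⟩
  iff f := by
    constructor
    · intro h t
      refine ⟨⟨fun ⟨i, hi⟩ => h.1 t ⟨i.succ, hi⟩, fun hy => h.2 t ?_⟩,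
        fun ht => h.2 t (Or.inl ⟨0, by simpa using ht⟩)⟩
      rcases hy with ⟨i, hi⟩ | hl
      · exact Or.inl ⟨i.succ, by simpa using hi⟩
      · exact Or.inr (by simpa using hl)
    · intro h
      refine ⟨?_, ?_⟩
      · rintro t ⟨i, hi⟩
        revert hi
        refine Fin.cases (fun hi => ?_) (fun j hj => (h t).1.1 ⟨j, hj⟩) i
        rw [(h t).2 hi]
        exact x₀.2
      · rintro t (⟨i, hi⟩ | hl)
        · revert hi
          refine Fin.cases (fun hi => (h t).2 (by simpa using hi)) (fun j hj => ?_) i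
          exact (h t).1.2 (Or.inl ⟨j, by simpa using hj⟩)
        · exact (h t).1.2 (Or.inr (by simpa using hl))

/-- The group structure of `π_n(X, A, x₀)`, `n ≥ 2`: concatenation in the first coordinate. -/
noncomputable instance (n : ℕ) (A : Set X) (x₀ : A) : AddGroup (RelHomotopyGroup (n + 1) X A x₀) :=
  (isConcatenable_triples n A x₀).addGroup

/-- The base point of `π_{n+1}(X, A, x₀)`, the class of the constant map. -/
def RelHomotopyGroup.base (n : ℕ) (A : Set X) (x₀ : A) : RelHomotopyGroup n X A x₀ :=
  HomotopyClasses.mk (PsMap.const (x₀ : X)) ⟨fun _ _ => x₀.2, fun _ _ => rfl⟩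

/-- The base point of the set `π_1(X, A, x₀)`, written `0`. -/
instance (A : Set X) (x₀ : A) : Zero (RelHomotopyGroup 0 X A x₀) :=
  ⟨RelHomotopyGroup.base 0 A x₀⟩

/-- The neutral element of the group `π_n(X, A, x₀)`, `n ≥ 2`, is the base point. -/
theorem RelHomotopyGroup.zero_eq_base (n : ℕ) (A : Set X) (x₀ : A) :
    (0 : RelHomotopyGroup (n + 1) X A x₀) = RelHomotopyGroup.base (n + 1) A x₀ := rfl

/-- The map `f_* : π_n(X, x₀) → π_n(Y, f(x₀))`. -/
def HomotopyGroup.map (n : ℕ) (f : PsMap X Y) (x₀ : X) :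
    HomotopyGroup n X x₀ → HomotopyGroup n Y (f x₀) :=
  HomotopyClasses.postcomp f fun _ hg t ht => congrArg f.toFun (hg t ht)

/-- The map `f_* : π_{n+1}(X, A, x₀) → π_{n+1}(Y, B, y₀)` of a map of pointed pairs. -/
def RelHomotopyGroup.map (n : ℕ) {A : Set X} {B : Set Y} {x₀ : A} {y₀ : B} (f : PsMap X Y)
    (hAB : IsMapOfPairs A B f) (h₀ : f (x₀ : X) = y₀) :
    RelHomotopyGroup n X A x₀ → RelHomotopyGroup n Y B y₀ :=
  HomotopyClasses.postcomp f fun _ hg =>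
    ⟨fun t ht => hAB _ (hg.1 t ht), fun t ht => (congrArg f.toFun (hg.2 t ht)).trans h₀⟩

theorem horn_subset_bd (n : ℕ) : horn n ⊆ bd (n + 1) := by
  rintro t (⟨i, hi⟩ | h)
  · exact ⟨i.castSucc, hi⟩
  · exact ⟨Fin.last n, Or.inl h⟩

/-- The identification of `π_{n+1}(X, x₀)` with `π_{n+1}(X, {x₀}, x₀)`, by the identity on
representatives. -/
def HomotopyGroup.equivRel (n : ℕ) (x₀ : X) :
    HomotopyGroup (n + 1) X x₀ ≃ RelHomotopyGroup n X ({x₀} : Set X) ⟨x₀, rfl⟩ :=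
  Quotient.congr (Equiv.subtypeEquivRight fun _ =>
      ⟨fun h => ⟨h, fun t ht => h t (horn_subset_bd n ht)⟩, fun h => h.1⟩) (by
    rintro f g
    constructor
    · rintro ⟨H, h0, h1, hP⟩
      exact ⟨H, h0, h1, fun s => ⟨hP s, fun t ht => hP s t (horn_subset_bd n ht)⟩⟩
    · rintro ⟨H, h0, h1, hP⟩
      exact ⟨H, h0, h1, fun s => (hP s).1⟩)

/-- The identity map of `X`. -/
def PsMap.id (X : Type u) [PseudotopologicalSpace X] : PsMap X X := ⟨fun x => x, psContinuous_id⟩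

/-! ### The maps of the homotopy sequence -/

variable (A : Set X) (x₀ : A)

/-- `i_* : π_n(A, x₀) → π_n(X, x₀)`, for `n ≥ 1`. -/
def iStar (n : ℕ) : HomotopyGroup n A x₀ → HomotopyGroup n X (x₀ : X) :=
  HomotopyGroup.map n (incl A) x₀

/-- `i_* : π₀(A, x₀) → π₀(X, x₀)`. -/
def iStar₀ : Pi0 A x₀ → Pi0 X (x₀ : X) := Pi0.map (incl A) x₀

/-- `j_* : π_{n+1}(X, x₀) = π_{n+1}(X, {x₀}, x₀) → π_{n+1}(X, A, x₀)`, induced by the inclusion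
`(X, {x₀}, x₀) → (X, A, x₀)`, for `n ≥ 0`. -/
def jStar (n : ℕ) : HomotopyGroup (n + 1) X (x₀ : X) → RelHomotopyGroup n X A x₀ :=
  fun a => RelHomotopyGroup.map n (x₀ := (⟨(x₀ : X), rfl⟩ : ({(x₀ : X)} : Set X))) (PsMap.id X)
    (by rintro x rfl; exact x₀.2) rfl (HomotopyGroup.equivRel n (x₀ : X) a)

theorem snoc_mem_bd {n : ℕ} (t : PsCube n) :
    (Fin.snoc t 1 : PsCube (n + 1)) ∈ bd (n + 1) :=
  ⟨Fin.last n, Or.inr (by simp)⟩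

theorem snoc_mem_horn {n : ℕ} {t : PsCube n} (h : t ∈ bd n) :
    (Fin.snoc t 1 : PsCube (n + 1)) ∈ horn n := by
  refine Or.inl ?_
  simpa using h

theorem continuous_snoc_one (n : ℕ) :
    Continuous (fun t : PsCube n => (Fin.snoc t 1 : PsCube (n + 1))) := by
  refine continuous_pi fun i => ?_
  refine Fin.lastCases ?_ (fun j => ?_) i
  · simpa using continuous_const
  · simpa using continuous_apply j

/-- The restriction of a map of triples `(I^{n+1}, ∂I^{n+1}, J^n) → (X, A, x₀)` to the face
`I^n = I^n × {1}`. -/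
def faceMap {n : ℕ} (f : PsMap (PsCube (n + 1)) X)
    (hf : IsMapOfTriples (bd (n + 1)) (horn n) A ({(x₀ : X)} : Set X) f) : PsMap (PsCube n) A :=
  ⟨fun t => ⟨f (Fin.snoc t 1), hf.1 _ (snoc_mem_bd t)⟩,
    (f.continuous_toFun.comp (psContinuous_cube (continuous_snoc_one n))).subtypeMk _⟩

/-- The boundary operator `∂ : π_{n+1}(X, A, x₀) → π_n(A, x₀)`, for `n ≥ 1`. -/
def boundaryMap (n : ℕ) : RelHomotopyGroup n X A x₀ → HomotopyGroup n A x₀ :=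
  Quotient.map (fun f => ⟨faceMap A x₀ f.1 f.2,
      fun t ht => Subtype.ext (f.2.2 _ (snoc_mem_horn ht))⟩) (by
    rintro ⟨f, hf⟩ ⟨g, hg⟩ ⟨H, h0, h1, hP⟩
    dsimp only at h0 h1
    subst h0 h1
    have hc : PsContinuous (fun p : PsCube n × I => ((Fin.snoc p.1 1 : PsCube (n + 1)), p.2)) :=
      ((psContinuous_cube (continuous_snoc_one n)).comp psContinuous_fst).prodMk psContinuous_snd
    refine ⟨⟨fun p => ⟨H (Fin.snoc p.1 1, p.2), (hP p.2).1 _ (snoc_mem_bd p.1)⟩,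
      (H.continuous_toFun.comp hc).subtypeMk _⟩, rfl, rfl, fun s t ht => ?_⟩
    exact Subtype.ext ((hP s).2 _ (snoc_mem_horn ht)))

/-- The boundary operator `∂ : π_1(X, A, x₀) → π₀(A, x₀)`, `[f] ↦ [f(1)]`. -/
def boundaryMap₀ : RelHomotopyGroup 0 X A x₀ → Pi0 A x₀ :=
  Quotient.map (fun f => ⟨f.1 (fun _ => 1), f.2.1 _ ⟨0, Or.inr rfl⟩⟩) (by
    rintro ⟨f, hf⟩ ⟨g, hg⟩ ⟨H, h0, h1, hP⟩
    dsimp only at h0 h1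
    subst h0 h1
    refine ⟨⟨fun s => ⟨H (fun _ => 1, s), (hP s).1 _ ⟨0, Or.inr rfl⟩⟩,
      (H.continuous_toFun.comp ((psContinuous_const _).prodMk psContinuous_id)).subtypeMk _⟩,
      rfl, rfl⟩)

end HomotopyGroups

end PsTop

namespace PsTop

open Filter Set
open scoped unitInterval Topology
open PseudotopologicalSpace

/-! ### Continuity on cubes -/

/-! The classical argument works because every homotopy it needs is either a given map composed with
an ordinary continuous map of cubes, or two such maps glued along a closed half. Convergence in a
cube is topological convergence, so reparametrizations can be checked in ordinary topology. The only
gluing uses `PsContinuous.glue`, which holds for any pseudotopological target.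

Write a point of `I^{n+1}` as `(y, s)` with `s` the last coordinate. A map of triples is constant on
`J^n` and is free only on the top face `s = 1`, which goes into `A`; read along `s`, it is a
contraction in `X`, relative to `∂I^n`, of its top face. This gives exactness at `π_n(A)`
(`exists_isMapOfTriples_of_contraction`, `exists_contraction_of_isMapOfTriples`). If the top face
contracts already inside `A`, stacking that contraction on top of the map makes the whole boundary
constant, which gives exactness at `π_{n+1}(X, A)` (`exists_isMapOfPairs_of_contraction`).

At `π_{n+1}(X)`, a nullhomotopy through triples is a family of squares in the last coordinate and
the time. Sweeping a segment across the square, from the edge carrying the given map to the edge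
lying over `A`, deforms the map into `A` while the boundary stays at `x₀`
(`exists_homotopic_into_subspace`). Conversely, a map into `A` can be pushed down along `s`
(`homotopic_const_of_into_subspace`).

The homomorphism statements hold on representatives, since none of the three maps affects the first
coordinate, where concatenation takes place. -/

theorem psContinuous_cube_prod_unit {m : ℕ} {φ : PsCube m × I → I} (h : Continuous φ) :
    PsContinuous φ :=
  fun _ p hF => (h.tendsto p).mono_left (conv_cube_prod_iff.1 hF)

theorem psContinuous_cube_prod_prod {m n : ℕ} {φ : PsCube m × I → PsCube n × I}
    (h : Continuous φ) : PsContinuous φ :=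
  fun _ p hF => conv_cube_prod_iff.2 ((h.tendsto p).mono_left (conv_cube_prod_iff.1 hF))

theorem psContinuous_prod_of_cube {m n : ℕ} {φ : PsCube m → PsCube n × I}
    (h : Continuous φ) : PsContinuous φ :=
  fun _ t hF => conv_cube_prod_iff.2 ((h.tendsto t).mono_left (conv_cube_iff.1 hF))

/-! ### The last coordinate of a cube and the faces of its boundary -/

/-- The first `n` coordinates of a point of `I^{n+1}`. -/
def initial {n : ℕ} (t : PsCube (n + 1)) : PsCube n := fun i => t i.castSucc

@[fun_prop] theorem continuous_initial (n : ℕ) :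
    Continuous (initial : PsCube (n + 1) → PsCube n) :=
  continuous_pi fun i => continuous_apply i.castSucc

@[simp] theorem initial_snoc {n : ℕ} (y : PsCube n) (s : I) :
    initial (Fin.snoc y s : PsCube (n + 1)) = y := by
  funext i; simp [initial]

theorem snoc_initial {n : ℕ} {t : PsCube (n + 1)} {s : I} (h : t (Fin.last n) = s) :
    (Fin.snoc (initial t) s : PsCube (n + 1)) = t := by
  subst h
  exact Fin.snoc_init_self t

theorem continuous_snoc {Z : Type u} [TopologicalSpace Z] {n : ℕ} {f : Z → PsCube n} {g : Z → I}
    (hf : Continuous f) (hg : Continuous g) :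
    Continuous (fun z => (Fin.snoc (f z) (g z) : PsCube (n + 1))) :=
  Continuous.finSnoc (A := fun _ => I) hf hg

theorem mem_horn_iff {n : ℕ} {t : PsCube (n + 1)} :
    t ∈ horn n ↔ initial t ∈ bd n ∨ t (Fin.last n) = 0 := Iff.rfl

/-- Isolates the top face, the only part of the boundary on which a map of triples may differ from
`x₀`. -/
theorem mem_bd_succ_iff {n : ℕ} {t : PsCube (n + 1)} :
    t ∈ bd (n + 1) ↔ t ∈ horn n ∨ t (Fin.last n) = 1 := by
  constructor
  · rintro ⟨i, hi⟩
    revert hi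
    refine Fin.lastCases (fun hi => ?_) (fun j hj => Or.inl (Or.inl ⟨j, hj⟩)) i
    exact hi.imp Or.inr id
  · rintro (h | h)
    · exact horn_subset_bd n h
    · exact ⟨Fin.last n, Or.inr h⟩

/-! ### Deformations of maps of pairs and triples -/

section Maps

variable {X : Type u} [PseudotopologicalSpace X] {n : ℕ}

/-- Since `x₀ ∈ A`, the condition on the boundary has content only on the top face. In this form,
triples and pairs differ only in what is asked there. -/
theorem isMapOfTriples_iff {A : Set X} {x₀ : A} {f : PsMap (PsCube (n + 1)) X} :
    IsMapOfTriples (bd (n + 1)) (horn n) A ({(x₀ : X)} : Set X) f ↔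
      (∀ t ∈ horn n, f t = x₀) ∧ ∀ t, t (Fin.last n) = 1 → f t ∈ A := by
  constructor
  · exact fun h => ⟨h.2, fun t ht => h.1 t (mem_bd_succ_iff.2 (Or.inr ht))⟩
  · refine fun h => ⟨fun t ht => ?_, h.1⟩
    rcases mem_bd_succ_iff.1 ht with ht | ht
    · rw [h.1 t ht]; exact x₀.2
    · exact h.2 t ht

theorem isMapOfPairs_iff {x₀ : X} {f : PsMap (PsCube (n + 1)) X} :
    IsMapOfPairs (bd (n + 1)) ({x₀} : Set X) f ↔
      (∀ t ∈ horn n, f t = x₀) ∧ ∀ t, t (Fin.last n) = 1 → f t = x₀ := by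
  constructor
  · exact fun h => ⟨fun t ht => h t (horn_subset_bd n ht),
      fun t ht => h t (mem_bd_succ_iff.2 (Or.inr ht))⟩
  · refine fun h t ht => ?_
    rcases mem_bd_succ_iff.1 ht with ht | ht
    exacts [h.1 t ht, h.2 t ht]

variable {A : Set X} {x₀ : A}

/-- A contraction in `X`, relative to `∂I^n`, of a map `(I^n, ∂I^n) → (A, x₀)` is, with time
reversed, a map of triples which restricts to the given map on the last face. -/
theorem exists_isMapOfTriples_of_contraction (K : PsMap (PsCube n × I) X)
    (h0 : ∀ y, K (y, 0) ∈ A) (h1 : ∀ y, K (y, 1) = x₀) (hb : ∀ y ∈ bd n, ∀ s, K (y, s) = x₀) :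
    ∃ f : PsMap (PsCube (n + 1)) X,
      IsMapOfTriples (bd (n + 1)) (horn n) A ({(x₀ : X)} : Set X) f ∧
      ∀ y, f (Fin.snoc y 1) = K (y, 0) := by
  -- The reversal puts the constant end of `K` on the bottom face, which belongs to `J^n`.
  have hc : Continuous (fun t : PsCube (n + 1) =>
      (initial t, unitInterval.symm (t (Fin.last n)))) := by fun_prop
  refine ⟨K.comp ⟨_, psContinuous_prod_of_cube hc⟩, isMapOfTriples_iff.2 ⟨?_, ?_⟩, ?_⟩
  · rintro t (ht | ht)
    · exact hb _ ht _
    · simpa [PsMap.comp, ht] using h1 _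
  · intro t ht
    simpa [PsMap.comp, ht] using h0 _
  · intro y
    simp [PsMap.comp]

/-- The last face of a map of triples contracts in `X` relative to `∂I^n`. -/
theorem exists_contraction_of_isMapOfTriples {f : PsMap (PsCube (n + 1)) X}
    (hf : IsMapOfTriples (bd (n + 1)) (horn n) A ({(x₀ : X)} : Set X) f) :
    ∃ K : PsMap (PsCube n × I) X, (∀ y, K (y, 0) = f (Fin.snoc y 1)) ∧
      (∀ y, K (y, 1) = x₀) ∧ ∀ y ∈ bd n, ∀ s, K (y, s) = x₀ := by
  have hc : Continuous (fun p : PsCube n × I =>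
      (Fin.snoc p.1 (unitInterval.symm p.2) : PsCube (n + 1))) :=
    continuous_snoc continuous_fst (by fun_prop)
  refine ⟨f.comp ⟨_, psContinuous_cube_prod hc⟩, ?_, ?_, ?_⟩
  · intro y; simp [PsMap.comp]
  · exact fun y => hf.2 _ (Or.inr (by simp))
  · exact fun y hy s => hf.2 _ (mem_horn_iff.2 (Or.inl (by simpa using hy)))

/-- If the last face of a map of triples contracts in `A` relative to `∂I^n`, then the map is
homotopic to a map which is constant on the whole boundary. -/
theorem exists_isMapOfPairs_of_contraction {f : PsMap (PsCube (n + 1)) X}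
    (hf : IsMapOfTriples (bd (n + 1)) (horn n) A ({(x₀ : X)} : Set X) f)
    (K : PsMap (PsCube n × I) A) (h0 : ∀ y, (K (y, 0) : X) = f (Fin.snoc y 1))
    (h1 : ∀ y, K (y, 1) = x₀) (hb : ∀ y ∈ bd n, ∀ s, K (y, s) = x₀) :
    ∃ g : PsMap (PsCube (n + 1)) X, IsMapOfPairs (bd (n + 1)) ({(x₀ : X)} : Set X) g ∧
      HomotopicThrough (IsMapOfTriples (bd (n + 1)) (horn n) A ({(x₀ : X)} : Set X)) g f := by
  -- Stack `f` (heights `0` to `1/2`) below `K` (heights `1/2` to `1`). At time `u` the cube is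
  -- stretched over the heights from `0` to `(1 + u) / 2`: only `f` is seen at `u = 0`, the whole
  -- stack at `u = 1`.
  let v : PsCube (n + 1) × I → I := fun p => ⟨(p.1 (Fin.last n) : ℝ) * (1 + (p.2 : ℝ)) / 2, by
    have a := (p.1 (Fin.last n)).2
    have b := p.2.2
    constructor
    · have := mul_nonneg a.1 b.1; nlinarith [a.1]
    · nlinarith [a.1, a.2, b.1, b.2]⟩
  have hv : Continuous v := Continuous.subtype_mk (by fun_prop) _
  have hv' (p : PsCube (n + 1) × I) :
    (v p : ℝ) = (p.1 (Fin.last n) : ℝ) * (1 + (p.2 : ℝ)) / 2 := rfl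
  have c1 : Continuous (fun p : PsCube (n + 1) × I =>
      (Fin.snoc (initial p.1) (dbl (v p)) : PsCube (n + 1))) :=
    continuous_snoc (by fun_prop) (continuous_dbl.comp hv)
  have c2 : Continuous (fun p : PsCube (n + 1) × I => (initial p.1, dbl' (v p))) :=
    Continuous.prodMk (by fun_prop) (continuous_dbl'.comp hv)
  let G : PsMap (PsCube (n + 1) × I) X := ⟨_, PsContinuous.glue (psContinuous_cube_prod_unit hv)
    (f.continuous_toFun.comp (psContinuous_cube_prod c1))
    (((psContinuous_val A).comp K.continuous_toFun).comp (psContinuous_cube_prod_prod c2))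
    (by
      intro p hp
      rw [dbl_half hp, dbl'_half hp]
      exact (h0 _).symm)⟩
  have hG (t : PsCube (n + 1)) (u : I) : G (t, u) = if (v (t, u) : ℝ) ≤ 1 / 2 then
      f (Fin.snoc (initial t) (dbl (v (t, u)))) else K (initial t, dbl' (v (t, u))) := rfl
  have horn_eq (t : PsCube (n + 1)) (ht : t ∈ horn n) (u : I) : G (t, u) = x₀ := by
    rw [hG]
    rcases ht with ht | ht
    · split_ifs
      · exact hf.2 _ (mem_horn_iff.2 (Or.inl (by rwa [initial_snoc])))
      · exact congrArg Subtype.val (hb _ ht _)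
    · have : (v (t, u) : ℝ) = 0 := by rw [hv']; simp [ht]
      rw [if_pos (by rw [this]; norm_num)]
      refine hf.2 _ (mem_horn_iff.2 (Or.inr ?_))
      rw [Fin.snoc_last]
      exact Subtype.ext (by rw [coe_dbl, this]; simp)
  -- At time `u` the top face is the stage of `K` at time `u`: it stays in `A` throughout and is
  -- constant at `u = 1`.
  have last_eq (t : PsCube (n + 1)) (ht : t (Fin.last n) = 1) (u : I) :
      G (t, u) = K (initial t, u) := by
    have e : (v (t, u) : ℝ) = (1 + (u : ℝ)) / 2 := by rw [hv']; simp [ht]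
    have hu := u.2
    rw [hG]
    split_ifs with c
    · rw [e] at c
      -- The top face meets the lower half only at height `1/2`, that is at `u = 0`, where `f` and
      -- `K` agree.
      have hu0 : u = 0 := Subtype.ext (le_antisymm (by simpa using (by linarith : (u : ℝ) ≤ 0)) hu.1)
      subst hu0
      rw [h0, dbl_half (by rw [e]; simp)]
    · have : dbl' (v (t, u)) = u :=
        Subtype.ext (by rw [coe_dbl', e, max_eq_right] <;> linarith [hu.1])
      rw [this]
  refine ⟨G.stage 1, isMapOfPairs_iff.2 ⟨fun t ht => horn_eq t ht 1, fun t ht => ?_⟩,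
    HomotopicThrough.symm ⟨G, ?_, rfl, fun u => isMapOfTriples_iff.2
      ⟨fun t ht => horn_eq t ht u, fun t ht => ?_⟩⟩⟩
  · exact (last_eq t ht 1).trans (congrArg Subtype.val (h1 _))
  · ext t
    change G (t, 0) = f t
    have e : (v (t, 0) : ℝ) = (t (Fin.last n) : ℝ) / 2 := by rw [hv']; simp
    have ht := (t (Fin.last n)).2
    rw [hG, if_pos (by rw [e]; linarith [ht.2]), snoc_initial]
    refine Subtype.ext ?_
    rw [coe_dbl, e, min_eq_right] <;> linarith [ht.2]
  · change G (t, u) ∈ A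
    rw [last_eq t ht u]
    exact (K _).2

/-- A map `(I^{n+1}, ∂I^{n+1}) → (X, x₀)` which is null-homotopic as a map of triples is homotopic
to a map into `A`. -/
theorem exists_homotopic_into_subspace {f : PsMap (PsCube (n + 1)) X}
    (hf : IsMapOfPairs (bd (n + 1)) ({(x₀ : X)} : Set X) f)
    (h : HomotopicThrough (IsMapOfTriples (bd (n + 1)) (horn n) A ({(x₀ : X)} : Set X)) f
      (PsMap.const (x₀ : X))) :
    ∃ g : PsMap (PsCube (n + 1)) A, IsMapOfPairs (bd (n + 1)) ({x₀} : Set A) g ∧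
      HomotopicThrough (IsMapOfPairs (bd (n + 1)) ({(x₀ : X)} : Set X)) ((incl A).comp g) f := by
  obtain ⟨H, H0, H1, hP⟩ := h
  replace hP (u : I) := isMapOfTriples_iff.1 (hP u)
  have e0 (t) : H (t, 0) = f t := congrArg (fun k : PsMap _ X => k t) H0
  have e1 (t) : H (t, 1) = x₀ := congrArg (fun k : PsMap _ X => k t) H1
  have eh (t) (ht : t ∈ horn n) (r : I) : H (t, r) = x₀ := (hP r).1 t ht
  -- the path in the square from the point `(x, y)` to the corner `(1, 0)`
  let α : I → I → I := fun x s => ⟨(1 - (s : ℝ)) * (x : ℝ) + s, by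
    have := mul_nonneg (sub_nonneg.2 s.2.2) x.2.1
    have := mul_nonneg (sub_nonneg.2 s.2.2) (sub_nonneg.2 x.2.2)
    exact ⟨by linarith [s.2.1], by linarith⟩⟩
  let β : I → I → I := fun y s => unitInterval.symm s * y
  -- In the square of pairs (last coordinate of `H`, time of `H`), the starting point `(dbl' u, dbl
  -- u)` runs from `(0, 0)` up to `(0, 1)` and then across to `(1, 1)`, along edges where `H` is
  -- `x₀`. The last coordinate of `t` parametrizes the segment from there to `(1, 0)`.
  have hc : Continuous (fun p : PsCube (n + 1) × I =>
      ((Fin.snoc (initial p.1) (α (dbl' p.2) (p.1 (Fin.last n))) : PsCube (n + 1)),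
        β (dbl p.2) (p.1 (Fin.last n)))) := by
    have d := continuous_dbl
    have d' := continuous_dbl'
    refine Continuous.prodMk (continuous_snoc (by fun_prop) ?_) (by fun_prop)
    exact Continuous.subtype_mk (by fun_prop) _
  let G : PsMap (PsCube (n + 1) × I) X := H.comp ⟨_, psContinuous_cube_prod_prod hc⟩
  have hG (t : PsCube (n + 1)) (u : I) : G (t, u) =
      H (Fin.snoc (initial t) (α (dbl' u) (t (Fin.last n))), β (dbl u) (t (Fin.last n))) := rfl
  have hGp (u : I) : IsMapOfPairs (bd (n + 1)) ({(x₀ : X)} : Set X) (G.stage u) := by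
    refine isMapOfPairs_iff.2 ⟨?_, ?_⟩
    · rintro t (ht | ht)
      · exact eh _ (mem_horn_iff.2 (Or.inl (by rwa [initial_snoc]))) _
      · change G (t, u) = x₀
        rw [hG, ht]
        -- For `u ≤ 1/2` the segment starts on the bottom face, in `J^n`; for `u ≥ 1/2` it starts at
        -- time `1`, where `H` is constant.
        rcases le_total (u : ℝ) (1 / 2) with hu | hu
        · refine eh _ (mem_horn_iff.2 (Or.inr ?_)) _
          rw [Fin.snoc_last]
          refine Subtype.ext ?_
          simp only [α, coe_dbl']
          rw [max_eq_left (by linarith)]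
          simp
        · have : dbl u = 1 := Subtype.ext (by rw [coe_dbl, min_eq_left (by linarith)]; rfl)
          simp only [β, this, unitInterval.symm_zero, mul_one, e1]
    · intro t ht
      change G (t, u) = x₀
      -- Every segment ends at `(1, 0)`, where `H` is `f` on its top face, hence `x₀`.
      have hα : α (dbl' u) 1 = 1 := Subtype.ext (by simp [α])
      rw [hG, ht, hα]
      simp only [β, unitInterval.symm_one, zero_mul, e0]
      exact (isMapOfPairs_iff.1 hf).2 _ (by simp)
  have hα1 (s : I) : α 1 s = 1 := Subtype.ext (by simp [α])
  have hd : dbl 1 = 1 := Subtype.ext (by rw [coe_dbl]; norm_num)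
  have hd' : dbl' 0 = 0 := Subtype.ext (by rw [coe_dbl']; norm_num)
  -- At `u = 1` the segment joins `(1, 1)` to `(1, 0)`, inside the edge that every stage of `H`
  -- sends to `A`.
  have hA (t) : G (t, 1) ∈ A := by
    rw [hG, dbl'_one, hα1]
    exact (hP _).2 _ (by simp)
  refine ⟨⟨_, (G.stage 1).continuous_toFun.subtypeMk hA⟩,
    fun t ht => Subtype.ext (hGp 1 t ht), HomotopicThrough.symm ⟨G, ?_, rfl, hGp⟩⟩
  ext t
  change G (t, 0) = f t
  -- At `u = 0` the segment is the edge from `(0, 0)` to `(1, 0)`, along which `H` is `f`.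
  have hα0 (s : I) : α 0 s = s := Subtype.ext (by simp [α])
  rw [hG, hd', hα0, snoc_initial rfl, dbl_zero]
  simp only [β, mul_zero, e0]

/-- A map `(I^{n+1}, ∂I^{n+1}) → (A, x₀)` is null-homotopic as a map of triples to `(X, A, x₀)`. -/
theorem homotopic_const_of_into_subspace {g : PsMap (PsCube (n + 1)) A}
    (hg : IsMapOfPairs (bd (n + 1)) ({x₀} : Set A) g) :
    HomotopicThrough (IsMapOfTriples (bd (n + 1)) (horn n) A ({(x₀ : X)} : Set X))
      ((incl A).comp g) (PsMap.const (x₀ : X)) := by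
  -- Shrinking the last coordinate to `0` pushes the cube onto its bottom face, where `g` is
  -- constant. The top face moves, but only within `A`.
  have hc : Continuous (fun p : PsCube (n + 1) × I =>
      (Fin.snoc (initial p.1) (unitInterval.symm p.2 * p.1 (Fin.last n)) : PsCube (n + 1))) :=
    continuous_snoc (by fun_prop) (by fun_prop)
  have hh (t) (ht : t ∈ horn n) : g t = x₀ := hg t (horn_subset_bd n ht)
  refine ⟨((incl A).comp g).comp ⟨_, psContinuous_cube_prod hc⟩, ?_, ?_, fun u =>
    isMapOfTriples_iff.2 ⟨?_, fun t _ => Subtype.coe_prop _⟩⟩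
  · ext t
    simp [PsMap.stage, PsMap.comp, snoc_initial]
  · ext t
    exact congrArg Subtype.val (hh _ (mem_horn_iff.2 (Or.inr (by simp))))
  · rintro t (ht | ht)
    · exact congrArg Subtype.val (hh _ (mem_horn_iff.2 (Or.inl (by rwa [initial_snoc]))))
    · exact congrArg Subtype.val (hh _ (mem_horn_iff.2 (Or.inr (by simp [ht]))))

/-- Turns the vanishing of a class into a pointwise contraction relative to `∂I^n`, the form used by
the deformation lemmas. -/
theorem homotopicThrough_pairs_const_iff {g : PsMap (PsCube n) X} {x : X} :
    HomotopicThrough (IsMapOfPairs (bd n) ({x} : Set X)) g (PsMap.const x) ↔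
      ∃ K : PsMap (PsCube n × I) X, (∀ y, K (y, 0) = g y) ∧ (∀ y, K (y, 1) = x) ∧
        ∀ y ∈ bd n, ∀ s, K (y, s) = x := by
  constructor
  · rintro ⟨K, h0, h1, hP⟩
    exact ⟨K, fun y => congrArg (fun k : PsMap _ X => k y) h0,
      fun y => congrArg (fun k : PsMap _ X => k y) h1, fun y hy s => hP s y hy⟩
  · rintro ⟨K, h0, h1, hP⟩
    exact ⟨K, PsMap.ext h0, PsMap.ext h1, fun s y hy => hP y hy s⟩

end Maps

/-! ### Homomorphisms -/

section Sequence

variable {X : Type u} [PseudotopologicalSpace X] (A : Set X) (x₀ : A)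

theorem iStar_add (n : ℕ) (a b : HomotopyGroup (n + 1) A x₀) :
    iStar A x₀ (n + 1) (a + b) = iStar A x₀ (n + 1) a + iStar A x₀ (n + 1) b := by
  induction a using Quotient.inductionOn with | _ f
  induction b using Quotient.inductionOn with | _ g
  refine congrArg (Quotient.mk _) (Subtype.ext (PsMap.ext fun t => ?_))
  exact apply_ite Subtype.val _ _ _

/-- Both sides have the same representative: only the condition imposed on it changes. -/
theorem jStar_add (n : ℕ) (a b : HomotopyGroup (n + 2) X (x₀ : X)) :
    jStar A x₀ (n + 1) (a + b) = jStar A x₀ (n + 1) a + jStar A x₀ (n + 1) b := by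
  induction a using Quotient.inductionOn
  induction b using Quotient.inductionOn
  rfl

theorem snoc_zero {n : ℕ} (t : PsCube (n + 1)) (s : I) :
    (Fin.snoc t s : PsCube (n + 2)) 0 = t 0 :=
  Fin.snoc_castSucc (α := fun _ => I) s t 0

theorem first_snoc {n : ℕ} (φ : I → I) (t : PsCube (n + 1)) (s : I) :
    first φ (Fin.snoc t s : PsCube (n + 2)) = Fin.snoc (first φ t) s := by
  rw [first, snoc_zero]
  exact (Fin.snoc_update (α := fun _ => I) s t 0 (φ (t 0))).symm

/-- The cube here is `I^{n+2}`, so the coordinate of concatenation and the one fixed by the face are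
distinct, and restriction to the face commutes with concatenation. -/
theorem boundaryMap_add (n : ℕ) (a b : RelHomotopyGroup (n + 1) X A x₀) :
    boundaryMap A x₀ (n + 1) (a + b) =
      boundaryMap A x₀ (n + 1) a + boundaryMap A x₀ (n + 1) b := by
  induction a using Quotient.inductionOn with | _ f
  induction b using Quotient.inductionOn with | _ g
  refine congrArg (Quotient.mk _) (Subtype.ext (PsMap.ext fun t => Subtype.ext ?_))
  change concatFun f.1.toFun g.1.toFun (Fin.snoc t 1) = Subtype.val (concatFun _ _ t)
  simp only [concatFun, snoc_zero, first_snoc]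
  split_ifs <;> rfl

/-! ### Exactness -/

theorem exact_boundaryMap_iStar (n : ℕ) :
    Function.Exact (boundaryMap A x₀ (n + 1)) (iStar A x₀ (n + 1)) := by
  intro a
  induction a using Quotient.inductionOn with | _ g
  obtain ⟨g, hg⟩ := g
  constructor
  · intro h
    obtain ⟨K, h0, h1, hb⟩ := homotopicThrough_pairs_const_iff.1 (Quotient.exact h)
    obtain ⟨f, hf, e⟩ := exists_isMapOfTriples_of_contraction (A := A) (x₀ := x₀) K
      (fun y => by rw [h0]; exact (g y).2) h1 hb
    refine ⟨HomotopyClasses.mk f hf, congrArg (Quotient.mk _) (Subtype.ext (PsMap.ext fun y =>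
      Subtype.ext ((e y).trans (h0 y))))⟩
  · rintro ⟨b, hb⟩
    rw [← hb]
    induction b using Quotient.inductionOn with | _ f
    exact Quotient.sound (homotopicThrough_pairs_const_iff.2
      (exists_contraction_of_isMapOfTriples f.2))

/-- Phrased with `base` so that one statement serves both the pointed set `π_1(X, A, x₀)` and the
higher groups, whose `0` is `base` by definition. -/
theorem jStar_eq_base_iff (n : ℕ) (a : HomotopyGroup (n + 1) X (x₀ : X)) :
    jStar A x₀ n a = RelHomotopyGroup.base n A x₀ ↔ a ∈ range (iStar A x₀ (n + 1)) := by
  constructor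
  · induction a using Quotient.inductionOn with | _ f
    intro h
    obtain ⟨g, hg, hgf⟩ := exists_homotopic_into_subspace f.2 (Quotient.exact h)
    exact ⟨HomotopyClasses.mk g hg, Quotient.sound hgf⟩
  · rintro ⟨b, rfl⟩
    induction b using Quotient.inductionOn with | _ g
    exact Quotient.sound (homotopic_const_of_into_subspace g.2)

theorem exact_jStar_boundaryMap (n : ℕ) :
    Function.Exact (jStar A x₀ (n + 1)) (boundaryMap A x₀ (n + 1)) := by
  intro a
  constructor
  · induction a using Quotient.inductionOn with | _ f
    intro h
    obtain ⟨K, h0, h1, hb⟩ := homotopicThrough_pairs_const_iff.1 (Quotient.exact h)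
    obtain ⟨g, hg, hgf⟩ := exists_isMapOfPairs_of_contraction f.2 K
      (fun y => congrArg Subtype.val (h0 y)) h1 hb
    exact ⟨HomotopyClasses.mk g hg, Quotient.sound hgf⟩
  · rintro ⟨b, rfl⟩
    induction b using Quotient.inductionOn with | _ f
    -- A map of pairs is already `x₀` on the top face, so no homotopy is needed.
    exact congrArg (Quotient.mk _) (Subtype.ext (PsMap.ext fun y =>
      Subtype.ext (f.2 _ (snoc_mem_bd y))))

/-- Reconciles the top face of `I^1` with the endpoint used in `boundaryMap₀`. -/
theorem snoc_one_eq (y : PsCube 0) : (Fin.snoc y 1 : PsCube 1) = fun _ => 1 := by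
  funext i
  rw [show i = Fin.last 0 from Fin.fin_one_eq_zero i, Fin.snoc_last]

theorem exact_jStar_boundaryMap_zero :
    Function.Exact (jStar A x₀ 0) (boundaryMap₀ A x₀) := by
  intro a
  constructor
  · induction a using Quotient.inductionOn with | _ f
    intro h
    obtain ⟨α, h0, h1⟩ := Quotient.exact h
    -- Equality in `π₀` gives a path rather than a homotopy on `I^0`. Precomposed with the
    -- projection from `I^0 × I`, it is a contraction; the condition on `∂I^0 = ∅` is vacuous.
    obtain ⟨g, hg, hgf⟩ := exists_isMapOfPairs_of_contraction f.2
      (α.comp ⟨Prod.snd, psContinuous_snd⟩)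
      (fun y => by rw [snoc_one_eq]; exact congrArg Subtype.val h0) (fun _ => h1)
      (fun _ hy => hy.elim fun i => i.elim0)
    exact ⟨HomotopyClasses.mk g hg, Quotient.sound hgf⟩
  · rintro ⟨b, rfl⟩
    induction b using Quotient.inductionOn with | _ f
    exact congrArg (Quotient.mk _) (Subtype.ext (f.2 _ ⟨0, Or.inr rfl⟩))

theorem exact_boundaryMap_iStar_zero : Function.Exact (boundaryMap₀ A x₀) (iStar₀ A x₀) := by
  intro a
  constructor
  · induction a using Quotient.inductionOn with | _ x
    intro h
    obtain ⟨α, h0, h1⟩ := Quotient.exact h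
    obtain ⟨f, hf, e⟩ := exists_isMapOfTriples_of_contraction (n := 0) (A := A) (x₀ := x₀)
      (α.comp ⟨Prod.snd, psContinuous_snd⟩) (fun _ => by
        change α 0 ∈ A
        rw [h0]; exact x.2) (fun _ => h1)
      (fun _ hy => hy.elim fun i => i.elim0)
    refine ⟨HomotopyClasses.mk f hf, congrArg (Quotient.mk _) (Subtype.ext ?_)⟩
    have e' := e Fin.elim0
    rw [snoc_one_eq] at e'
    exact e'.trans h0
  · rintro ⟨b, rfl⟩
    induction b using Quotient.inductionOn with | _ f
    obtain ⟨K, h0, h1, -⟩ := exists_contraction_of_isMapOfTriples f.2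
    -- Over the unique point of `I^0`, the contraction is a path in `X` from `f(1)` to `x₀`.
    refine Quotient.sound ⟨K.comp ⟨fun s => (Fin.elim0, s),
      (psContinuous_const _).prodMk psContinuous_id⟩, ?_, h1 _⟩
    exact (h0 _).trans (by rw [snoc_one_eq]; rfl)

end Sequence

end PsTop

theorem mainTheorem5 {X : Type u} [PsTop.PseudotopologicalSpace X] (A : Set X) (x₀ : A) :
    -- the maps between groups are homomorphisms
    (∀ (n : ℕ) (a b : PsTop.HomotopyGroup (n + 1) A x₀),
      PsTop.iStar A x₀ (n + 1) (a + b) =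
        PsTop.iStar A x₀ (n + 1) a + PsTop.iStar A x₀ (n + 1) b) ∧
    (∀ (n : ℕ) (a b : PsTop.HomotopyGroup (n + 2) X (x₀ : X)),
      PsTop.jStar A x₀ (n + 1) (a + b) =
        PsTop.jStar A x₀ (n + 1) a + PsTop.jStar A x₀ (n + 1) b) ∧
    (∀ (n : ℕ) (a b : PsTop.RelHomotopyGroup (n + 1) X A x₀),
      PsTop.boundaryMap A x₀ (n + 1) (a + b) =
        PsTop.boundaryMap A x₀ (n + 1) a + PsTop.boundaryMap A x₀ (n + 1) b) ∧
    -- exactness at `π_{n+1}(A, x₀)`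
    (∀ n : ℕ, Function.Exact (PsTop.boundaryMap A x₀ (n + 1)) (PsTop.iStar A x₀ (n + 1))) ∧
    -- exactness at `π_1(X, x₀)` and at `π_{n+2}(X, x₀)`
    Function.Exact (PsTop.iStar A x₀ 1) (PsTop.jStar A x₀ 0) ∧
    (∀ n : ℕ, Function.Exact (PsTop.iStar A x₀ (n + 2)) (PsTop.jStar A x₀ (n + 1))) ∧
    -- exactness at `π_{n+2}(X, A, x₀)`
    (∀ n : ℕ, Function.Exact (PsTop.jStar A x₀ (n + 1)) (PsTop.boundaryMap A x₀ (n + 1))) ∧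
    -- exactness at `π_1(X, A, x₀)` and at `π_0(A, x₀)`
    Function.Exact (PsTop.jStar A x₀ 0) (PsTop.boundaryMap₀ A x₀) ∧
    Function.Exact (PsTop.boundaryMap₀ A x₀) (PsTop.iStar₀ A x₀) := by
  exact ⟨PsTop.iStar_add A x₀, PsTop.jStar_add A x₀, PsTop.boundaryMap_add A x₀,
    PsTop.exact_boundaryMap_iStar A x₀, PsTop.jStar_eq_base_iff A x₀ 0,
    fun n => PsTop.jStar_eq_base_iff A x₀ (n + 1), PsTop.exact_jStar_boundaryMap A x₀,
    PsTop.exact_jStar_boundaryMap_zero A x₀, PsTop.exact_boundaryMap_iStar_zero A x₀⟩
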